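/- *Conventions.* Rings are commutative with unit and $\mathbb N=\{0,1,2,\dots\}$. A *$d$-variate higher derivation* on a ring $R$ is a ring homomorphism $\theta\colon R\to R[[T_1,\dots,T_d]]$ with $\theta(r)|_{T=0}=r$ for all $r\in R$; for $\alpha\in\mathbb N^d$, $\theta^{(\alpha)}(r)$ denotes the coefficient of $T^\alpha$ in $\theta(r)$, and $\theta$ is *iterative* if $\theta^{(\alpha)}\circ\theta^{(\beta)}=\binom{\alpha+\beta}{\alpha}\theta^{(\alpha+\beta)}$ for all $\alpha,\beta\in\mathbb N^d$, where $\binom{\alpha+\beta}{\alpha}=\prod_i\binom{\alpha_i+\beta_i}{\alpha_i}$. If $R\to S$ is a ring homomorphism, a higher derivation on $S$ *extends* one on $R$ if the two are compatible with $R\to S$ and the induced map $R[[T_1,\dots,T_d]]\to S[[T_1,\dots,T_d]]$. Let $A$ be a commutative ring, $n\in\mathbb N$, and let $f=(f_1,\dots,f_n)$ be polynomials in $A[x]=A[x_1,\dots,x_n]$ whose Jacobian determinant $\det(\partial f_i/\partial x_j)_{i,j}$ is a unit of $A[x]$. Then $f_1,\dots,f_n$ are algebraically independent over $A$, so that there is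 a unique $A$-algebra homomorphism $\theta_f\colon A[f_1,\dots,f_n]\to A[f_1,\dots,f_n][[T_1,\dots,T_n]]$ with $\theta_f(f_i)=f_i+T_i$ for all $i$; it is an iterative $n$-variate higher derivation on $A[f_1,\dots,f_n]$, and it extends uniquely to an $n$-variate higher derivation on $A[x]$, also denoted $\theta_f$. Writing $\theta_{f_i}^{(L)}:=\theta_f^{(Le_i)}$ with $e_i$ the $i$-th unit vector, the extension has the following properties. 1. Suppose that $A$ has characteristic $p^e$ with $p$ prime and $e\in\mathbb N$. Then for all $L\ge 0$, all $i=1,\dots,n$, all $N\in\mathbb N$ with $p^{N-e+1}>L$ and all families of polynomials $a_\alpha\in A[x]$, indexed by the $\alpha\in\mathbb N^n$ with $0\le\alpha_j\le p^N-1$ for all $j$, $$\theta_{f_i}^{(L)}\Big(\sum_{\alpha}a_\alpha(x_1^{p^N},\dots,x_n^{p^N})\,f^\alpha\Big)=\sum_{\alpha}a_\alpha(x_1^{p^N},\dots,x_n^{p^N})\binom{\alpha_i}{L}f^{\alpha-Le_i},$$ where both sums run over these $\alpha$, $f^\alpha=f_1^{\alpha_1}\cdots f_n^{\alpha_n}$,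 and terms with $\alpha_i<L$ on the right are zero. In particular, this holds for $N=e+\operatorname{ord}_p(L!)$, where $\operatorname{ord}_p$ is the $p$-adic valuation. 2. $\theta_f$ is an iterative higher derivation on $A[x]$. Moreover, for each $i$ there is a unique $A$-derivation $\frac{\partial}{\partial f_i}$ of $A[x]$ with $\frac{\partial f_i}{\partial f_i}=1$ and $\frac{\partial f_j}{\partial f_i}=0$ for $j\ne i$, and for all $L>0$ $$L!\cdot\theta_{f_i}^{(L)}=\Big(\frac{\partial}{\partial f_i}\Big)^{L}.$$ 3. Let $\phi\colon A\to A'$ be a homomorphism of commutative rings, and let $\phi(f)=(\phi(f_1),\dots,\phi(f_n))$ be obtained by applying $\phi$ to the coefficients. Then $\phi(f_1),\dots,\phi(f_n)$ are algebraically independent over $A'$, the higher derivation $\theta_{\phi(f)}$ on $A'[\phi(f_1),\dots,\phi(f_n)]$ extends uniquely to a higher derivation $\theta_{\phi(f)}$ on $A'[x]$, and $\theta_{\phi(f)}\circ\phi_*=\phi_*\circ\theta_f$ as maps $A[x]\to A'[x][[T_1,\dots,T_n]]$, where $\phi_*$ denotes the maps $A[x]\to A'[x]$ and $A[x][[T_1,\dots,T_n]]\to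 A'[x][[T_1,\dots,T_n]]$ induced by $\phi$. -/

import Mathlib

universe u v

noncomputable section

/-- A `d`-variate higher derivation on a commutative ring `R`: a ring homomorphism
`θ : R → R[[T₁, …, T_d]]` such that `θ(r)|_{T = 0} = r` for all `r`. -/
@[ext]
structure HigherDerivation (d : ℕ) (R : Type*) [CommRing R] where
  /-- the underlying ring homomorphism -/
  toRingHom : R →+* MvPowerSeries (Fin d) R
  /-- evaluation at `T = 0` gives back the element -/
  constantCoeff_toRingHom : ∀ r : R, MvPowerSeries.constantCoeff (toRingHom r) = r

namespace HigherDerivation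

variable {d : ℕ} {R S : Type*} [CommRing R] [CommRing S]

/-- `θ^{(α)} : R → R`, the coefficient of `T^α` in `θ(r)`. -/
def component (θ : HigherDerivation d R) (α : Fin d →₀ ℕ) (r : R) : R :=
  MvPowerSeries.coeff α (θ.toRingHom r)

/-- `θ_i^{(L)} := θ^{(L e_i)}`, the components of the `i`-th univariate higher derivation
obtained from `θ` by sending `T_j` to `0` for `j ≠ i`. -/
def componentAt (θ : HigherDerivation d R) (i : Fin d) (L : ℕ) (r : R) : R :=
  θ.component (Finsupp.single i L) r

/-- `θ` is iterative: `θ^{(α)} ∘ θ^{(β)} = binom(α + β, α) θ^{(α + β)}` for all multi-indices,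
with the multi-index binomial coefficient. -/
def IsIterative (θ : HigherDerivation d R) : Prop :=
  ∀ (α β : Fin d →₀ ℕ) (r : R),
    θ.component α (θ.component β r)
      = (∏ i, ((α + β) i).choose (α i)) • θ.component (α + β) r

/-- The higher derivation `θ` on the `R`-algebra `S` extends the higher derivation `ψ` on `R`. -/
def Extends [Algebra R S] (θ : HigherDerivation d S) (ψ : HigherDerivation d R) : Prop :=
  ∀ r : R, θ.toRingHom (algebraMap R S r) =
    MvPowerSeries.map (algebraMap R S) (ψ.toRingHom r)

end HigherDerivation

/-- The elements `t_i`, viewed in the subalgebra `A[t₁, …, t_n]` of `B` that they generate. -/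
def adjoinGen (A : Type*) {B : Type*} [CommRing A] [CommRing B] [Algebra A B] {n : ℕ}
    (t : Fin n → B) (i : Fin n) : Algebra.adjoin A (Set.range t) :=
  ⟨t i, Algebra.subset_adjoin (Set.mem_range_self i)⟩

/-- The `A`-algebra homomorphism `A[t₁, …, t_n] → A[t₁, …, t_n][[T₁, …, T_n]]` with
`t_i ↦ t_i + T_i`, for algebraically independent `t₁, …, t_n`. -/
def thetaHom {A B : Type*} [CommRing A] [CommRing B] [Algebra A B] {n : ℕ}
    {t : Fin n → B} (ht : AlgebraicIndependent A t) :
    Algebra.adjoin A (Set.range t) →ₐ[A]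
      MvPowerSeries (Fin n) (Algebra.adjoin A (Set.range t)) :=
  (MvPolynomial.aeval
    (fun i => MvPowerSeries.C (adjoinGen A t i) + MvPowerSeries.X i)).comp
    (ht.aevalEquiv.symm : Algebra.adjoin A (Set.range t) →ₐ[A] MvPolynomial (Fin n) A)

theorem constantCoeff_thetaHom {A B : Type*} [CommRing A] [CommRing B] [Algebra A B] {n : ℕ}
    {t : Fin n → B} (ht : AlgebraicIndependent A t) (r : Algebra.adjoin A (Set.range t)) :
    MvPowerSeries.constantCoeff (thetaHom ht r) = r := by
  obtain ⟨q, rfl⟩ := ht.aevalEquiv.surjective r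
  have h : (ht.aevalEquiv.symm : Algebra.adjoin A (Set.range t) →ₐ[A] MvPolynomial (Fin n) A)
      (ht.aevalEquiv q) = q := ht.aevalEquiv.symm_apply_apply q
  rw [thetaHom, AlgHom.comp_apply, h]
  clear h
  induction q using MvPolynomial.induction_on with
  | C a => simp [MvPowerSeries.algebraMap_apply]
  | add p q hp hq => simp only [map_add, hp, hq]
  | mul_X p i hp =>
    simp only [map_mul, hp]
    congr 1
    apply Subtype.ext
    simp [adjoinGen]

/-- The higher derivation `θ_t` on `A[t₁, …, t_n]` with respect to `t₁, …, t_n`. -/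
def theta {A B : Type*} [CommRing A] [CommRing B] [Algebra A B] {n : ℕ}
    {t : Fin n → B} (ht : AlgebraicIndependent A t) :
    HigherDerivation n (Algebra.adjoin A (Set.range t)) where
  toRingHom := (thetaHom ht : Algebra.adjoin A (Set.range t) →+*
    MvPowerSeries (Fin n) (Algebra.adjoin A (Set.range t)))
  constantCoeff_toRingHom := constantCoeff_thetaHom ht

/-- The Jacobian matrix `(∂f_i / ∂x_j)_{i,j}`. -/
def jacobianMatrix {A : Type*} [CommRing A] {n : ℕ} (f : Fin n → MvPolynomial (Fin n) A) :
    Matrix (Fin n) (Fin n) (MvPolynomial (Fin n) A) :=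
  Matrix.of fun i j => MvPolynomial.pderiv j (f i)

/-- The `A`-derivation `D` of `A[x]` is `∂/∂f_i`, i.e. `D(f_i) = 1` and `D(f_j) = 0`
for `j ≠ i`. -/
def IsPartialDerivative {A : Type*} [CommRing A] {n : ℕ} (f : Fin n → MvPolynomial (Fin n) A)
    (i : Fin n)
    (D : Derivation A (MvPolynomial (Fin n) A) (MvPolynomial (Fin n) A)) : Prop :=
  ∀ j, D (f j) = if j = i then 1 else 0

/-- The formula
`θ_i^{(L)} (∑_α a_α(x₁^q, …, x_n^q) f^α) = ∑_α a_α(x₁^q, …, x_n^q) binom(α_i, L) f^(α - L e_i)`,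
for all families of polynomials `a_α`, the sums running over the multi-indices `α` with all
entries `< q`. The truncation in `α - L e_i` is harmless: if `α_i < L`, the binomial coefficient
vanishes. -/
def PowerFormula {A : Type*} [CommRing A] {n : ℕ} (f : Fin n → MvPolynomial (Fin n) A)
    (θ : HigherDerivation n (MvPolynomial (Fin n) A)) (q : ℕ) (i : Fin n) (L : ℕ) : Prop :=
  ∀ a : (Fin n → ℕ) → MvPolynomial (Fin n) A,
    θ.componentAt i L
        (∑ α ∈ Fintype.piFinset (fun _ : Fin n => Finset.range q),
          MvPolynomial.expand q (a α) * ∏ j, f j ^ α j)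
      = ∑ α ∈ Fintype.piFinset (fun _ : Fin n => Finset.range q),
          MvPolynomial.expand q (a α) *
            (((α i).choose L : MvPolynomial (Fin n) A) *
              ∏ j, f j ^ ((α - Pi.single i L : Fin n → ℕ) j))

end

/-! Everything rests on one principle: since the Jacobian of `f` is invertible, a homomorphism from
`A[x]` to a power series ring is determined by its constant term, its values on `A` and its values
on the `f j`. This is formal étaleness of `A[f] → A[x]` in explicit form. For uniqueness
(`ringHom_ext_of_isUnit_jacobian`), if two lifts agree to order `k` on the `x_j`, the Taylor
expansion of `f` and the inverse Jacobian force agreement to order `k + 1`. For existence, Newton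
iteration solves `f(g) = f(x) + T`.

The rest follows. If `P(f) = 0`, then applying the lift gives `P(f + T) = 0`, and substituting `T -
f` for `T` gives `P = 0`. Iterativity and base change each compare two homomorphisms with the same
data, so they are instances of uniqueness.

For the formula in characteristic `p ^ e`, the lift moves `x_k` only by multiples of `T`. The
binomial coefficients of `p ^ N` are divisible by `p ^ e` in low degree, so the `p ^ N`-th powers of
the `x_k` are constant modulo `T_i ^ (L + 1)`. Only the monomial in `f` is differentiated, and there
the binomial theorem applies. -/

section Taylor

/-! ### Congruences and first-order Taylor expansion -/

variable {σ A S : Type*} [CommRing A] [CommRing S]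

theorem MvPolynomial.map_sub_map_mem_of_congr (φ ψ : MvPolynomial σ A →+* S) (K : Ideal S)
    (hC : ∀ a, φ (C a) = ψ (C a)) (hX : ∀ i, φ (X i) - ψ (X i) ∈ K) (P : MvPolynomial σ A) :
    φ P - ψ P ∈ K := by
  rw [← Ideal.Quotient.eq]
  refine RingHom.congr_fun (f := (Ideal.Quotient.mk K).comp φ)
    (g := (Ideal.Quotient.mk K).comp ψ) (MvPolynomial.ringHom_ext ?_ ?_) P
  · intro a
    simp [hC]
  · intro i
    exact Ideal.Quotient.eq.mpr (hX i)

/-- First order Taylor expansion of a polynomial, with the remainder controlled by ideals. -/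
theorem MvPolynomial.taylor_remainder_mem [Fintype σ] (φ ψ χ : MvPolynomial σ A →+* S)
    {I K K' : Ideal S} (hK : K * I ≤ K')
    (hφψ : ∀ a, φ (C a) = ψ (C a)) (hψχ : ∀ a, ψ (C a) = χ (C a))
    (hK_mem : ∀ i, φ (X i) - ψ (X i) ∈ K) (hφ : ∀ i, φ (X i) - χ (X i) ∈ I)
    (hψ : ∀ i, ψ (X i) - χ (X i) ∈ I) (P : MvPolynomial σ A) :
    φ P - ψ P - ∑ j, χ (pderiv j P) * (φ (X j) - ψ (X j)) ∈ K' := by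
  classical
  induction P using MvPolynomial.induction_on with
  | C a => simp [hφψ]
  | add P Q hP hQ =>
    convert K'.add_mem hP hQ using 1
    simp only [map_add, add_mul, Finset.sum_add_distrib]
    ring
  | mul_X P i hP =>
    -- The remainder of `P * X i` splits into the old remainder times `χ (X i)` and two products of
    -- a difference in `K` with one in `I`.
    have h1 := K'.mul_mem_right (χ (X i)) hP
    have h2 := hK (Ideal.mul_mem_mul (map_sub_map_mem_of_congr φ ψ K hφψ hK_mem P) (hφ i))
    have h3 := hK (Ideal.mul_mem_mul (hK_mem i) (map_sub_map_mem_of_congr ψ χ I hψχ hψ P))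
    convert K'.add_mem (K'.add_mem h1 h2) h3 using 1
    have hs : ∑ j, χ (pderiv j (P * X i)) * (φ (X j) - ψ (X j))
        = (∑ j, χ (pderiv j P) * (φ (X j) - ψ (X j))) * χ (X i)
          + χ P * (φ (X i) - ψ (X i)) := by
      have : ∀ j, χ (pderiv j (P * X i)) * (φ (X j) - ψ (X j))
          = χ (pderiv j P) * (φ (X j) - ψ (X j)) * χ (X i)
            + if j = i then χ P * (φ (X i) - ψ (X i)) else 0 := by
        intro j
        rw [pderiv_mul, pderiv_X]
        by_cases h : j = i
        · subst h
          simp only [Pi.single_eq_same, map_add, map_mul, map_one, if_true]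
          ring
        · simp only [Pi.single_apply, map_add, map_mul, if_neg h, if_neg (Ne.symm h), map_zero]
          ring
      simp only [this, Finset.sum_add_distrib, Finset.sum_mul, Finset.sum_ite_eq',
        Finset.mem_univ, if_true]
    rw [hs]
    simp only [map_mul]
    ring

end Taylor

/-! ### The order filtration on power series -/

namespace MvPowerSeries

variable (σ : Type*) (R : Type*) [CommRing R]

/-- The ideal of power series of order at least `k`. -/
def orderIdeal (k : ℕ) : Ideal (MvPowerSeries σ R) where
  carrier := {h | (k : ℕ∞) ≤ h.order}
  add_mem' ha hb := (le_min ha hb).trans min_order_le_add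
  zero_mem' := by simp
  smul_mem' c h hh := by
    rw [smul_eq_mul]
    exact (le_add_of_nonneg_of_le zero_le hh).trans le_order_mul

variable {σ R}

theorem mem_orderIdeal {k : ℕ} {h : MvPowerSeries σ R} :
    h ∈ orderIdeal σ R k ↔ ∀ α : σ →₀ ℕ, α.degree < k → coeff α h = 0 :=
  ⟨fun hh α hα => coeff_of_lt_order (lt_of_lt_of_le (by exact_mod_cast hα) hh),
    fun hh => nat_le_order hh⟩

theorem orderIdeal_mul_le (j k : ℕ) :
    orderIdeal σ R j * orderIdeal σ R k ≤ orderIdeal σ R (j + k) :=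
  Ideal.mul_le.mpr fun a ha b hb => by
    have ha : (j : ℕ∞) ≤ a.order := ha
    have hb : (k : ℕ∞) ≤ b.order := hb
    change ((j + k : ℕ) : ℕ∞) ≤ (a * b).order
    push_cast
    exact (add_le_add ha hb).trans le_order_mul

theorem orderIdeal_anti {j k : ℕ} (h : j ≤ k) : orderIdeal σ R k ≤ orderIdeal σ R j :=
  fun _ hx => mem_orderIdeal.mpr fun α hα => mem_orderIdeal.mp hx α (hα.trans_le h)

theorem mem_orderIdeal_one {h : MvPowerSeries σ R} :
    h ∈ orderIdeal σ R 1 ↔ constantCoeff h = 0 := by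
  rw [← one_le_order_iff_constCoeff_eq_zero]
  exact Iff.of_eq (congrArg (· ≤ h.order) Nat.cast_one)

theorem eq_zero_of_forall_mem_orderIdeal {h : MvPowerSeries σ R}
    (hh : ∀ k, h ∈ orderIdeal σ R k) : h = 0 := by
  ext α
  exact mem_orderIdeal.mp (hh (α.degree + 1)) α (Nat.lt_succ_self _)

end MvPowerSeries

section Jacobian

open MvPowerSeries

/-! ### Uniqueness and existence of lifts -/

theorem jacobianMatrix_inverse {A : Type*} [CommRing A] {n : ℕ}
    {f : Fin n → MvPolynomial (Fin n) A} (hf : IsUnit (jacobianMatrix f).det) :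
    ∃ M : Matrix (Fin n) (Fin n) (MvPolynomial (Fin n) A),
      jacobianMatrix f * M = 1 ∧ M * jacobianMatrix f = 1 :=
  ⟨_, Matrix.mul_nonsing_inv _ hf, Matrix.nonsing_inv_mul _ hf⟩

/-- Lifts along `S⟦T⟧ → S` of homomorphisms out of `A[x]` are determined by the values at
polynomials with invertible Jacobian. -/
theorem ringHom_ext_of_isUnit_jacobian {A : Type*} [CommRing A] {n : ℕ}
    {f : Fin n → MvPolynomial (Fin n) A} (hf : IsUnit (jacobianMatrix f).det)
    {τ R : Type*} [CommRing R] {φ ψ : MvPolynomial (Fin n) A →+* MvPowerSeries τ R}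
    (hC : ∀ a, φ (MvPolynomial.C a) = ψ (MvPolynomial.C a))
    (h0 : ∀ g, constantCoeff (φ g) = constantCoeff (ψ g))
    (hφψ : ∀ j, φ (f j) = ψ (f j)) : φ = ψ := by
  obtain ⟨M, -, hM⟩ := jacobianMatrix_inverse hf
  have h1 : ∀ i, φ (MvPolynomial.X i) - ψ (MvPolynomial.X i) ∈ orderIdeal τ R 1 := fun i =>
    mem_orderIdeal_one.mpr (by rw [map_sub, h0, sub_self])
  have key : ∀ k, ∀ i, φ (MvPolynomial.X i) - ψ (MvPolynomial.X i) ∈ orderIdeal τ R (k + 1) := by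
    intro k
    induction k with
    | zero => exact h1
    | succ k ih =>
      -- As `φ` and `ψ` agree on `f l`, the linear Taylor term is, up to sign, the remainder, hence
      -- one order smaller than the differences `φ (X j) - ψ (X j)`. Applying `ψ (M)` then isolates
      -- each difference.
      have ht : ∀ l, ∑ j, ψ (MvPolynomial.pderiv j (f l))
          * (φ (MvPolynomial.X j) - ψ (MvPolynomial.X j)) ∈ orderIdeal τ R (k + 1 + 1) := by
        intro l
        have := MvPolynomial.taylor_remainder_mem φ ψ ψ (orderIdeal_mul_le (k + 1) 1) hC
          (fun _ => rfl) ih h1 (fun i => by simp) (f l)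
        rwa [hφψ, sub_self, zero_sub, neg_mem_iff] at this
      intro i
      have hsum := Ideal.sum_mem _ (fun l (_ : l ∈ Finset.univ) =>
        Ideal.mul_mem_left _ (ψ (M i l)) (ht l))
      convert hsum using 1
      simp only [Finset.mul_sum]
      rw [Finset.sum_comm]
      have : ∀ j, ∑ l, ψ (M i l) * (ψ (MvPolynomial.pderiv j (f l))
          * (φ (MvPolynomial.X j) - ψ (MvPolynomial.X j)))
          = if i = j then φ (MvPolynomial.X j) - ψ (MvPolynomial.X j) else 0 := by
        intro j
        simp only [← mul_assoc, ← map_mul, ← Finset.sum_mul, ← map_sum]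
        have h := congrFun (congrFun hM i) j
        rw [Matrix.mul_apply] at h
        simp only [jacobianMatrix, Matrix.of_apply, Matrix.one_apply] at h
        rw [h]
        split_ifs <;> simp
      simp [this]
  refine MvPolynomial.ringHom_ext hC fun i => sub_eq_zero.mp ?_
  exact eq_zero_of_forall_mem_orderIdeal fun k => orderIdeal_anti (Nat.le_succ k) (key k i)

/-- The inverse function theorem over a ring of formal power series: `f(g) = f(x) + T` has a
solution `g` with constant term `x`, by Newton iteration. -/
theorem exists_algHom_mvPowerSeries_of_isUnit_jacobian {A : Type*} [CommRing A] {n : ℕ}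
    {f : Fin n → MvPolynomial (Fin n) A} (hf : IsUnit (jacobianMatrix f).det) :
    ∃ θ : MvPolynomial (Fin n) A →ₐ[A] MvPowerSeries (Fin n) (MvPolynomial (Fin n) A),
      (∀ g, constantCoeff (θ g) = g) ∧ ∀ j, θ (f j) = C (f j) + X j := by
  obtain ⟨M, hM, -⟩ := jacobianMatrix_inverse hf
  let R := MvPolynomial (Fin n) A
  let F := orderIdeal (Fin n) R
  let ev : (Fin n → MvPowerSeries (Fin n) R) → R →+* MvPowerSeries (Fin n) R := fun g =>
    (MvPolynomial.aeval (R := A) g : R →ₐ[A] MvPowerSeries (Fin n) R)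
  have evC : ∀ g a, ev g (MvPolynomial.C a) = C (MvPolynomial.C a) := by
    intro g a
    exact (MvPolynomial.aeval_C g a).trans
      (by rw [MvPowerSeries.algebraMap_apply, MvPolynomial.algebraMap_eq])
  have evX : ∀ g i, ev g (MvPolynomial.X i) = g i := by
    intro g i
    exact MvPolynomial.aeval_X g i
  let err : (Fin n → MvPowerSeries (Fin n) R) → Fin n → MvPowerSeries (Fin n) R := fun g l =>
    ev g (f l) - (C (f l) + X l)
  -- The inverse Jacobian is kept at the base point `x` instead of being recomputed at `g`. Each
  -- step then gains only one order, which is enough, and the Taylor lemma is applied with its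
  -- derivative at `x`.
  let newton : (Fin n → MvPowerSeries (Fin n) R) → Fin n → MvPowerSeries (Fin n) R := fun g i =>
    g i - ∑ l, C (M i l) * err g l
  let G : ℕ → Fin n → MvPowerSeries (Fin n) R := fun m =>
    newton^[m] (fun i => C (MvPolynomial.X i))
  have G_succ : ∀ m, G (m + 1) = newton (G m) := fun m => Function.iterate_succ_apply' _ _ _
  have step_mem : ∀ k g, (∀ l, err g l ∈ F k) → ∀ i, newton g i - g i ∈ F k := by
    intro k g hg i
    have : newton g i - g i = -∑ l, C (M i l) * err g l := by simp only [newton]; ring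
    rw [this]
    exact neg_mem (Ideal.sum_mem _ fun l _ => Ideal.mul_mem_left _ _ (hg l))
  have hconst : ∀ g : R, ev (fun i => C (MvPolynomial.X i)) g = C g := by
    intro g
    refine RingHom.congr_fun (MvPolynomial.ringHom_ext ?_ ?_) g
    · exact evC _
    · exact evX _
  have key : ∀ m, (∀ i, G m i - C (MvPolynomial.X i) ∈ F 1) ∧ ∀ l, err (G m) l ∈ F (m + 1) := by
    intro m
    induction m with
    | zero =>
      refine ⟨fun i => by simp [G], fun l => ?_⟩
      change ev (fun i => C (MvPolynomial.X i)) (f l) - (C (f l) + X l) ∈ _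
      rw [hconst, sub_add_cancel_left]
      exact mem_orderIdeal_one.mpr (by simp)
    | succ m ih =>
      obtain ⟨ih1, ih2⟩ := ih
      have hs := step_mem (m + 1) (G m) ih2
      have h1 : ∀ i, G (m + 1) i - C (MvPolynomial.X i) ∈ F 1 := by
        intro i
        rw [G_succ, ← sub_add_sub_cancel _ (G m i)]
        exact Ideal.add_mem _ (orderIdeal_anti (by omega) (hs i)) (ih1 i)
      refine ⟨h1, fun l => ?_⟩
      have ht := MvPolynomial.taylor_remainder_mem (ev (G (m + 1))) (ev (G m))
        (ev fun i => C (MvPolynomial.X i)) (orderIdeal_mul_le (m + 1) 1)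
        (fun a => by rw [evC, evC]) (fun a => by rw [evC, evC])
        (fun i => by rw [evX, evX, G_succ]; exact hs i)
        (fun i => by rw [evX, evX]; exact h1 i) (fun i => by rw [evX, evX]; exact ih1 i) (f l)
      convert ht using 1
      have : ∑ j, ev (fun i => C (MvPolynomial.X i)) (MvPolynomial.pderiv j (f l))
          * (ev (G (m + 1)) (MvPolynomial.X j) - ev (G m) (MvPolynomial.X j))
          = - err (G m) l := by
        have e : ∀ j, ev (fun i => C (MvPolynomial.X i)) (MvPolynomial.pderiv j (f l))
            * (ev (G (m + 1)) (MvPolynomial.X j) - ev (G m) (MvPolynomial.X j))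
            = - ∑ k, C (jacobianMatrix f l j * M j k) * err (G m) k := by
          intro j
          rw [hconst, evX, evX, G_succ]
          simp only [newton, jacobianMatrix, Matrix.of_apply, map_mul, mul_assoc,
            ← Finset.mul_sum]
          ring
        simp only [e, Finset.sum_neg_distrib]
        rw [Finset.sum_comm]
        simp only [← Finset.sum_mul, ← map_sum, ← Matrix.mul_apply, hM]
        simp [Matrix.one_apply]
      rw [this]
      simp only [err]
      ring
  -- Step `m` changes only coefficients of degree greater than `m`, so the coefficient at `α` has
  -- its limiting value from iterate `α.degree` on.
  let g : Fin n → MvPowerSeries (Fin n) R := fun i α => coeff α (G α.degree i)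
  have hcoeff : ∀ i m k (α : Fin n →₀ ℕ), α.degree ≤ m →
      coeff α (G (m + k) i) = coeff α (G m i) := by
    intro i m k α hα
    induction k with
    | zero => rfl
    | succ k ih =>
      rw [← ih, ← sub_eq_zero, ← map_sub, ← add_assoc, G_succ]
      exact mem_orderIdeal.mp (step_mem (m + k + 1) _ (key (m + k)).2 i) α (by omega)
  have hg : ∀ m i, g i - G m i ∈ F (m + 1) := by
    intro m i
    refine mem_orderIdeal.mpr fun α hα => ?_
    rw [map_sub, sub_eq_zero]
    obtain ⟨k, rfl⟩ := Nat.exists_eq_add_of_le (Nat.lt_succ_iff.mp hα)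
    exact (hcoeff i _ k α le_rfl).symm
  refine ⟨MvPolynomial.aeval g, ?_, ?_⟩
  · intro P
    have h := MvPolynomial.map_sub_map_mem_of_congr (ev g) (ev fun i => C (MvPolynomial.X i))
      (F 1) (fun a => by rw [evC, evC])
      (fun i => by rw [evX, evX]; exact hg 0 i) P
    rw [hconst, mem_orderIdeal_one, map_sub, sub_eq_zero, constantCoeff_C] at h
    exact h
  · intro j
    refine sub_eq_zero.mp (eq_zero_of_forall_mem_orderIdeal fun k => ?_)
    have h := MvPolynomial.map_sub_map_mem_of_congr (ev g) (ev (G k))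
      (F (k + 1)) (fun a => by rw [evC, evC]) (fun i => by rw [evX, evX]; exact hg k i) (f j)
    refine orderIdeal_anti (Nat.le_succ k) ?_
    convert Ideal.add_mem _ h ((key k).2 j) using 1
    simp only [err, sub_add_sub_cancel]
    rfl

/-! ### The substitution of `T + U` for `T` -/

theorem multichoose_eq_zero {n : ℕ} {γ α : Fin n →₀ ℕ} (h : ¬ α ≤ γ) :
    ∏ i, (γ i).choose (α i) = 0 := by
  rw [Finsupp.le_def, not_forall] at h
  obtain ⟨i, hi⟩ := h
  exact Finset.prod_eq_zero (Finset.mem_univ i) (Nat.choose_eq_zero_of_lt (not_le.mp hi))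

/-- Vandermonde's identity for multi-indices. -/
theorem multichoose_add {n : ℕ} (γ δ α : Fin n →₀ ℕ) :
    ∏ i, ((γ + δ) i).choose (α i)
      = ∑ q ∈ Finset.HasAntidiagonal.antidiagonal α,
          (∏ i, (γ i).choose (q.1 i)) * ∏ i, (δ i).choose (q.2 i) := by
  simp only [Finsupp.add_apply, Nat.add_choose_eq]
  rw [Finset.prod_univ_sum]
  refine Finset.sum_bij'
    (fun p _ => (Finsupp.equivFunOnFinite.symm fun i => (p i).1,
      Finsupp.equivFunOnFinite.symm fun i => (p i).2))
    (fun q _ i => (q.1 i, q.2 i)) ?_ ?_ ?_ ?_ ?_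
  · intro p hp
    rw [Finset.HasAntidiagonal.mem_antidiagonal]
    ext i
    exact Finset.HasAntidiagonal.mem_antidiagonal.mp (Fintype.mem_piFinset.mp hp i)
  · intro q hq
    rw [Fintype.mem_piFinset]
    intro i
    rw [Finset.HasAntidiagonal.mem_antidiagonal, ← Finset.HasAntidiagonal.mem_antidiagonal.mp hq]
    rfl
  · intro p _
    rfl
  · intro q _
    refine Prod.ext ?_ ?_ <;> (ext i; rfl)
  · intro p _
    exact Finset.prod_mul_distrib

/-- The coefficients of `h(T + U)`, as a power series in `U` with coefficients in `R⟦T⟧`. -/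
noncomputable def shiftFun {n : ℕ} {R : Type*} [CommRing R] (h : MvPowerSeries (Fin n) R) :
    MvPowerSeries (Fin n) (MvPowerSeries (Fin n) R) :=
  fun β α => (∏ i, ((α + β) i).choose (α i)) • coeff (α + β) h

theorem coeff_shiftFun {n : ℕ} {R : Type*} [CommRing R] (h : MvPowerSeries (Fin n) R)
    (α β : Fin n →₀ ℕ) :
    coeff α (coeff β (shiftFun h)) = (∏ i, ((α + β) i).choose (α i)) • coeff (α + β) h :=
  rfl

theorem shiftFun_mul {n : ℕ} {R : Type*} [CommRing R] (g h : MvPowerSeries (Fin n) R) :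
    shiftFun (g * h) = shiftFun g * shiftFun h := by
  ext β α
  simp only [coeff_mul, coeff_shiftFun, map_sum]
  rw [Finset.sum_comm]
  let H : (Fin n →₀ ℕ) × (Fin n →₀ ℕ) → (Fin n →₀ ℕ) × (Fin n →₀ ℕ) → R := fun q p =>
    ((∏ i, (p.1 i).choose (q.1 i)) • coeff p.1 g) * ((∏ i, (p.2 i).choose (q.2 i)) • coeff p.2 h)
  -- Translation by `q` identifies the splittings of `β` with those splittings `p` of `α + β` that
  -- dominate `q`; for every other `p` a binomial coefficient vanishes.
  have hsum : ∀ q ∈ Finset.HasAntidiagonal.antidiagonal α,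
      ∑ r ∈ Finset.HasAntidiagonal.antidiagonal β, H q (q.1 + r.1, q.2 + r.2)
        = ∑ p ∈ Finset.HasAntidiagonal.antidiagonal (α + β), H q p := by
    intro q hq
    rw [← Finset.sum_image (f := H q) (s := Finset.HasAntidiagonal.antidiagonal β)
      (g := fun r => (q.1 + r.1, q.2 + r.2))]
    · refine Finset.sum_subset ?_ ?_
      · intro p hp
        obtain ⟨r, hr, rfl⟩ := Finset.mem_image.mp hp
        rw [Finset.HasAntidiagonal.mem_antidiagonal] at *
        rw [← hq, ← hr]
        exact add_add_add_comm _ _ _ _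
      · intro p hp hp'
        by_cases h1 : q.1 ≤ p.1
        · by_cases h2 : q.2 ≤ p.2
          · refine absurd (Finset.mem_image.mpr ⟨(p.1 - q.1, p.2 - q.2), ?_, ?_⟩) hp'
            · rw [Finset.HasAntidiagonal.mem_antidiagonal] at *
              refine add_left_cancel (a := α) ?_
              rw [← hp, ← hq, add_add_add_comm, add_tsub_cancel_of_le h1,
                add_tsub_cancel_of_le h2]
            · simp only [add_tsub_cancel_of_le h1, add_tsub_cancel_of_le h2]
          · simp only [H, multichoose_eq_zero h2, zero_smul, mul_zero]
        · simp only [H, multichoose_eq_zero h1, zero_smul, zero_mul]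
    · intro r _ s _ hrs
      simp only [Prod.mk.injEq, add_right_inj] at hrs
      exact Prod.ext hrs.1 hrs.2
  have hsum' := Finset.sum_congr rfl hsum
  rw [Finset.sum_comm] at hsum'
  rw [Finset.smul_sum]
  calc _ = ∑ p ∈ Finset.HasAntidiagonal.antidiagonal (α + β), ∑ q ∈ Finset.HasAntidiagonal.antidiagonal α, H q p := by
        refine Finset.sum_congr rfl fun p hp => ?_
        rw [← Finset.HasAntidiagonal.mem_antidiagonal.mp hp, multichoose_add, Finset.sum_smul]
        refine Finset.sum_congr rfl fun q _ => ?_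
        simp only [H, smul_mul_smul_comm]
    _ = _ := by
      rw [Finset.sum_comm, ← hsum', Finset.sum_comm]

theorem shiftFun_C {n : ℕ} {R : Type*} [CommRing R] (r : R) :
    shiftFun (C r : MvPowerSeries (Fin n) R) = C (C r) := by
  classical
  ext β α
  rw [coeff_shiftFun, coeff_C, coeff_C]
  by_cases hβ : β = 0
  · subst hβ
    by_cases hα : α = 0
    · subst hα
      simp
    · simp [hα, coeff_C]
  · have : α + β ≠ 0 := fun h => hβ (add_eq_zero.mp h).2
    simp [this, hβ]

theorem shiftFun_X {n : ℕ} {R : Type*} [CommRing R] (j : Fin n) :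
    shiftFun (X j : MvPowerSeries (Fin n) R) = C (X j) + X j := by
  classical
  ext β α
  rw [coeff_shiftFun, coeff_X, map_add, map_add, coeff_C, coeff_X]
  by_cases hβ : β = 0
  · subst hβ
    have h0 : (0 : Fin n →₀ ℕ) ≠ Finsupp.single j 1 := by simp [eq_comm]
    simp [h0, coeff_X]
  · by_cases hα : α = 0
    · subst hα
      by_cases hj : β = Finsupp.single j 1
      · simp [hj]
      · simp [hj, hβ]
    · have h1 : α + β ≠ Finsupp.single j 1 := by
        intro h
        have := congrArg Finsupp.degree h
        rw [map_add, Finsupp.degree_single] at this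
        have ha := (Finsupp.degree_eq_zero_iff α).not.mpr hα
        have hb := (Finsupp.degree_eq_zero_iff β).not.mpr hβ
        omega
      by_cases hj : β = Finsupp.single j 1
      · simp [hj, coeff_one, hα]
      · simp [h1, hβ, hj]

/-- The substitution `T ↦ T + U` as a ring homomorphism `R⟦T⟧ → R⟦T⟧⟦U⟧`. -/
noncomputable def shiftHom (n : ℕ) (R : Type*) [CommRing R] :
    MvPowerSeries (Fin n) R →+* MvPowerSeries (Fin n) (MvPowerSeries (Fin n) R) where
  toFun := shiftFun
  map_one' := by simpa using shiftFun_C (n := n) (1 : R)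
  map_mul' := shiftFun_mul
  map_zero' := by
    ext β α
    simp [coeff_shiftFun]
  map_add' g h := by
    ext β α
    simp [coeff_shiftFun, smul_add]

theorem coeff_shiftHom {n : ℕ} {R : Type*} [CommRing R] (h : MvPowerSeries (Fin n) R)
    (α β : Fin n →₀ ℕ) :
    coeff α (coeff β (shiftHom n R h)) = (∏ i, ((α + β) i).choose (α i)) • coeff (α + β) h :=
  rfl

theorem constantCoeff_shiftHom {n : ℕ} {R : Type*} [CommRing R] (h : MvPowerSeries (Fin n) R) :
    constantCoeff (shiftHom n R h) = h := by
  ext α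
  rw [← coeff_zero_eq_constantCoeff_apply, coeff_shiftHom]
  simp

/-- Polynomials over which a homomorphism `f_j ↦ f_j + T_j` exists are algebraically
independent. -/
theorem algebraicIndependent_of_shift {A : Type*} [CommRing A] {n : ℕ}
    {f : Fin n → MvPolynomial (Fin n) A}
    (θ : MvPolynomial (Fin n) A →ₐ[A] MvPowerSeries (Fin n) (MvPolynomial (Fin n) A))
    (hθ : ∀ j, θ (f j) = C (f j) + X j) : AlgebraicIndependent A f := by
  rw [algebraicIndependent_iff]
  intro P hP
  let R := MvPolynomial (Fin n) A
  let u : MvPolynomial (Fin n) A →ₐ[A] MvPolynomial (Fin n) R :=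
    MvPolynomial.aeval fun i => MvPolynomial.C (f i) + MvPolynomial.X i
  have hu : ((MvPolynomial.coeToMvPowerSeries.ringHom (R := R)).comp (u : R →+* _)) =
      ((θ.comp (MvPolynomial.aeval f) : R →ₐ[A] MvPowerSeries (Fin n) R) :
        R →+* MvPowerSeries (Fin n) R) := by
    refine MvPolynomial.ringHom_ext ?_ ?_
    · intro a
      have h1 : u (MvPolynomial.C a) = algebraMap A _ a := u.commutes a
      have h2 : (θ.comp (MvPolynomial.aeval f)) (MvPolynomial.C a) = algebraMap A _ a :=
        (θ.comp (MvPolynomial.aeval f)).commutes a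
      change MvPolynomial.coeToMvPowerSeries.ringHom (u _) = (θ.comp (MvPolynomial.aeval f)) _
      rw [h1, h2]
      simp [MvPolynomial.algebraMap_apply, MvPowerSeries.algebraMap_apply,
        MvPolynomial.coeToMvPowerSeries.ringHom_apply, R, MvPolynomial.algebraMap_eq]
    · intro i
      simp [u, hθ, MvPolynomial.coeToMvPowerSeries.ringHom_apply]
  -- `u P` is `P(f + T)` as a polynomial in `T`. Being a polynomial matters: replacing `T` by `T -
  -- f` below makes no sense for power series, as `f` need not be nilpotent.
  have h0 : u P = 0 := by
    have := RingHom.congr_fun hu P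
    simp only [RingHom.comp_apply, RingHom.coe_coe, AlgHom.comp_apply, hP, map_zero] at this
    exact MvPolynomial.coe_injective _ _ (this.trans MvPolynomial.coe_zero.symm)
  let v : MvPolynomial (Fin n) R →ₐ[R] MvPolynomial (Fin n) R :=
    MvPolynomial.aeval fun i => MvPolynomial.X i - MvPolynomial.C (f i)
  have hv : (v : MvPolynomial (Fin n) R →+* MvPolynomial (Fin n) R).comp
      (u : MvPolynomial (Fin n) A →+* MvPolynomial (Fin n) R)
      = MvPolynomial.map MvPolynomial.C := by
    refine MvPolynomial.ringHom_ext ?_ ?_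
    · intro a
      have h1 : u (MvPolynomial.C a) = algebraMap A _ a := u.commutes a
      change v (u _) = _
      rw [h1]
      simp [MvPolynomial.algebraMap_apply, v, R, MvPolynomial.algebraMap_eq]
    · intro i
      simp [u, v]
  have := RingHom.congr_fun hv P
  rw [RingHom.comp_apply, RingHom.coe_coe, RingHom.coe_coe, h0, map_zero] at this
  exact MvPolynomial.map_injective _ (MvPolynomial.C_injective _ _) (by rw [← this, map_zero])

/-! ### Iterativity and unique extension -/

namespace HigherDerivation

variable {A : Type*} [CommRing A] {n : ℕ} {f : Fin n → MvPolynomial (Fin n) A}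

/-- Applying `θ` twice and substituting `T + U` for `T` in `θ` both send `f j` to `f j + T_j + U_j`
and both reduce to `θ` at `U = 0`. By uniqueness of lifts over the coefficient ring `R⟦T⟧` they
coincide; comparing coefficients gives the claim. -/
theorem isIterative_of_shift (hf : IsUnit (jacobianMatrix f).det)
    {θ : HigherDerivation n (MvPolynomial (Fin n) A)}
    (hC : ∀ a, θ.toRingHom (MvPolynomial.C a) = C (MvPolynomial.C a))
    (hθ : ∀ j, θ.toRingHom (f j) = C (f j) + X j) : θ.IsIterative := by
  have h : (MvPowerSeries.map θ.toRingHom).comp θ.toRingHom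
      = (shiftHom n _).comp θ.toRingHom := by
    refine ringHom_ext_of_isUnit_jacobian hf ?_ ?_ ?_
    · intro a
      simp only [RingHom.comp_apply, hC, map_C]
      exact (shiftFun_C _).symm
    · intro g
      rw [RingHom.comp_apply, RingHom.comp_apply, constantCoeff_shiftHom, constantCoeff_map,
        θ.constantCoeff_toRingHom]
    · intro j
      simp only [RingHom.comp_apply, hθ, map_add, map_C, map_X]
      rw [add_assoc]
      exact congrArg₂ (· + ·) (shiftFun_C _).symm (shiftFun_X _).symm
  intro α β r
  have := congrArg (fun s => coeff α (coeff β s)) (RingHom.congr_fun h r)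
  simp only [RingHom.comp_apply, coeff_shiftHom, coeff_map] at this
  exact this

theorem IsIterative.of_extends {d : ℕ} {R S : Type*} [CommRing R] [CommRing S] [Algebra R S]
    (hinj : Function.Injective (algebraMap R S)) {θ : HigherDerivation d S}
    {ψ : HigherDerivation d R} (hθ : θ.IsIterative) (h : θ.Extends ψ) : ψ.IsIterative := by
  have hc : ∀ α r, θ.component α (algebraMap R S r) = algebraMap R S (ψ.component α r) := by
    intro α r
    simp only [component, h r, coeff_map]
  intro α β r
  apply hinj
  rw [← hc, ← hc, hθ, hc, map_nsmul]

/-- `A[f]` is generated by constants and the `f j`, so from here on the extension property is only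
used through these values. -/
theorem extends_theta_iff (hind : AlgebraicIndependent A f)
    (θ : HigherDerivation n (MvPolynomial (Fin n) A)) :
    θ.Extends (theta hind) ↔
      (∀ a, θ.toRingHom (MvPolynomial.C a) = C (MvPolynomial.C a)) ∧
        ∀ j, θ.toRingHom (f j) = C (f j) + X j := by
  let B := Algebra.adjoin A (Set.range f)
  have hgen : ∀ j, (theta hind).toRingHom (adjoinGen A f j) = C (adjoinGen A f j) + X j := by
    intro j
    change thetaHom hind (adjoinGen A f j) = _
    have : (hind.aevalEquiv.symm : B →ₐ[A] MvPolynomial (Fin n) A) (adjoinGen A f j)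
        = MvPolynomial.X j := by
      change hind.aevalEquiv.symm (adjoinGen A f j) = _
      rw [AlgEquiv.symm_apply_eq]
      exact Subtype.ext (by simp [adjoinGen])
    rw [thetaHom, AlgHom.comp_apply, this, MvPolynomial.aeval_X]
  have halg : ∀ a, (theta hind).toRingHom (algebraMap A B a) = C (algebraMap A B a) := by
    intro a
    exact ((thetaHom hind).commutes a).trans (MvPowerSeries.algebraMap_apply ..)
  constructor
  · intro h
    constructor
    · intro a
      have := h (algebraMap A B a)
      rw [halg, map_C] at this
      exact this
    · intro j
      have := h (adjoinGen A f j)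
      rw [hgen, map_add, map_C, map_X] at this
      exact this
  · rintro ⟨h1, h2⟩ r
    have hcomp : (θ.toRingHom.comp (algebraMap B (MvPolynomial (Fin n) A))).comp
          (hind.aevalEquiv : MvPolynomial (Fin n) A →+* B)
        = ((MvPowerSeries.map (algebraMap B (MvPolynomial (Fin n) A))).comp
          (theta hind).toRingHom).comp (hind.aevalEquiv : MvPolynomial (Fin n) A →+* B) := by
      refine MvPolynomial.ringHom_ext ?_ ?_
      · intro a
        have : hind.aevalEquiv (MvPolynomial.C a) = algebraMap A B a :=
          hind.aevalEquiv.commutes a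
        simp only [RingHom.comp_apply, RingHom.coe_coe]
        rw [this, halg, map_C]
        exact h1 a
      · intro j
        have : hind.aevalEquiv (MvPolynomial.X j) = adjoinGen A f j :=
          Subtype.ext (by simp [adjoinGen])
        simp only [RingHom.comp_apply, RingHom.coe_coe]
        rw [this, hgen, map_add, map_C, map_X]
        exact h2 j
    obtain ⟨q, rfl⟩ := hind.aevalEquiv.surjective r
    exact RingHom.congr_fun hcomp q

theorem exists_extends_theta (hf : IsUnit (jacobianMatrix f).det) :
    ∃ hind : AlgebraicIndependent A f,
      ∃ θ : HigherDerivation n (MvPolynomial (Fin n) A), θ.Extends (theta hind) := by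
  obtain ⟨θ, h0, hθ⟩ := exists_algHom_mvPowerSeries_of_isUnit_jacobian hf
  refine ⟨algebraicIndependent_of_shift θ hθ, ⟨θ, h0⟩, (extends_theta_iff _ _).mpr ⟨?_, hθ⟩⟩
  intro a
  exact (θ.commutes a).trans (MvPowerSeries.algebraMap_apply ..)

theorem Extends.eq_of_theta (hf : IsUnit (jacobianMatrix f).det)
    {hind : AlgebraicIndependent A f} {θ η : HigherDerivation n (MvPolynomial (Fin n) A)}
    (hθ : θ.Extends (theta hind)) (hη : η.Extends (theta hind)) : η = θ := by
  rw [extends_theta_iff] at hθ hη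
  refine HigherDerivation.ext (ringHom_ext_of_isUnit_jacobian hf ?_ ?_ ?_)
  · intro a
    rw [hθ.1, hη.1]
  · intro g
    rw [θ.constantCoeff_toRingHom, η.constantCoeff_toRingHom]
  · intro j
    rw [hθ.2, hη.2]

end HigherDerivation

/-! ### Base change -/

theorem isUnit_det_jacobianMatrix_map {A A' : Type*} [CommRing A] [CommRing A'] {n : ℕ}
    {f : Fin n → MvPolynomial (Fin n) A} (hf : IsUnit (jacobianMatrix f).det) (phi : A →+* A') :
    IsUnit (jacobianMatrix fun i => MvPolynomial.map phi (f i)).det := by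
  have : jacobianMatrix (fun i => MvPolynomial.map phi (f i))
      = (MvPolynomial.map phi).mapMatrix (jacobianMatrix f) := by
    ext1 i j
    simp [jacobianMatrix, MvPolynomial.pderiv_map]
  rw [this, ← RingHom.map_det]
  exact hf.map _

theorem HigherDerivation.toRingHom_map_of_extends {A A' : Type*} [CommRing A] [CommRing A']
    {n : ℕ} {f : Fin n → MvPolynomial (Fin n) A} (hf : IsUnit (jacobianMatrix f).det)
    (phi : A →+* A') {hind : AlgebraicIndependent A f}
    {hind' : AlgebraicIndependent A' (fun i => MvPolynomial.map phi (f i))}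
    {θ : HigherDerivation n (MvPolynomial (Fin n) A)}
    {θ' : HigherDerivation n (MvPolynomial (Fin n) A')}
    (hθ : θ.Extends (theta hind)) (hθ' : θ'.Extends (theta hind'))
    (g : MvPolynomial (Fin n) A) :
    θ'.toRingHom (MvPolynomial.map phi g) =
      MvPowerSeries.map (MvPolynomial.map phi) (θ.toRingHom g) := by
  rw [extends_theta_iff] at hθ hθ'
  refine RingHom.congr_fun (f := θ'.toRingHom.comp (MvPolynomial.map phi))
    (g := (MvPowerSeries.map (MvPolynomial.map phi)).comp θ.toRingHom)
    (ringHom_ext_of_isUnit_jacobian hf ?_ ?_ ?_) g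
  · intro a
    simp [hθ.1, hθ'.1]
  · intro g
    simp [θ.constantCoeff_toRingHom, θ'.constantCoeff_toRingHom]
  · intro j
    simp [hθ.2, hθ'.2]

/-- Setting `T_j = 0` for all `j ≠ i`, as a homomorphism `R⟦T⟧ → R⟦T_i⟧`. -/
noncomputable def axisHom {n : ℕ} (R : Type*) [CommRing R] (i : Fin n) :
    MvPowerSeries (Fin n) R →+* PowerSeries R where
  toFun h := PowerSeries.mk fun L => coeff (Finsupp.single i L) h
  map_one' := by
    classical
    ext L
    simp [coeff_one, PowerSeries.coeff_one]
  map_mul' g h := by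
    classical
    ext L
    rw [PowerSeries.coeff_mk, coeff_mul, PowerSeries.coeff_mul, Finsupp.antidiagonal_single,
      Finset.sum_map]
    simp
  map_zero' := by
    ext L
    simp
  map_add' g h := by
    ext L
    simp

/-! ### Restriction to one variable `T_i` -/

section AxisHom

variable {n : ℕ} {R : Type*} [CommRing R] (i : Fin n)

theorem coeff_axisHom (h : MvPowerSeries (Fin n) R) (L : ℕ) :
    PowerSeries.coeff L (axisHom R i h) = coeff (Finsupp.single i L) h :=
  PowerSeries.coeff_mk L fun L => coeff (Finsupp.single i L) h

theorem axisHom_C (r : R) : axisHom R i (C r) = PowerSeries.C r := by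
  classical
  ext L
  rw [coeff_axisHom, coeff_C, PowerSeries.coeff_C]
  simp

theorem axisHom_X (j : Fin n) :
    axisHom R i (X j) = if j = i then PowerSeries.X else 0 := by
  classical
  ext L
  rw [coeff_axisHom, coeff_X]
  by_cases hj : j = i
  · subst hj
    simp [PowerSeries.coeff_X, (Finsupp.single_injective j).eq_iff]
  · simp [hj, Finsupp.single_eq_single_iff, Ne.symm hj]

end AxisHom

/-- Frobenius-like congruence: in characteristic `p ^ e`, taking `p ^ N`-th powers kills
perturbations up to order `p ^ (N - e + 1)`. -/
theorem PowerSeries.X_pow_dvd_pow_sub_pow {R : Type*} [CommRing R] {p e N L : ℕ}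
    (hp : p.Prime) (hR : (p ^ e : R) = 0)
    (hL : L ≠ 0 → ∀ m, m ≠ 0 → m ≤ L → e + m.factorization p ≤ N) {a b : PowerSeries R}
    (hab : PowerSeries.X ∣ a - b) :
    PowerSeries.X ^ (L + 1) ∣ a ^ p ^ N - b ^ p ^ N := by
  obtain ⟨h, hh⟩ := hab
  obtain rfl : a = PowerSeries.X * h + b := by rw [← hh, sub_add_cancel]
  rw [add_pow, Finset.sum_range_succ']
  simp only [pow_zero, one_mul, tsub_zero, Nat.choose_zero_right, Nat.cast_one, mul_one,
    add_sub_cancel_right]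
  refine Finset.dvd_sum fun k hk => ?_
  have hk : k + 1 ≤ p ^ N := Finset.mem_range.mp hk
  by_cases hkL : L ≤ k
  · rw [mul_pow, mul_assoc, mul_assoc]
    exact (pow_dvd_pow _ (by omega)).trans (dvd_mul_right _ _)
  · have hkN := hL (by omega) (k + 1) (by omega) (by omega)
    -- The `p`-adic valuation of this binomial coefficient is `N` minus that of `k + 1`.
    have hdvd : p ^ e ∣ (p ^ N).choose (k + 1) := by
      rw [hp.pow_dvd_iff_le_factorization (Nat.choose_pos hk).ne',
        Nat.factorization_choose_prime_pow hp hk (by omega)]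
      omega
    obtain ⟨c, hc⟩ := hdvd
    have h0 : ((p ^ N).choose (k + 1) : PowerSeries R) = 0 := by
      have := congrArg (PowerSeries.C (R := R)) hR
      rw [map_pow, map_natCast, map_zero] at this
      rw [hc, Nat.cast_mul, Nat.cast_pow, this, zero_mul]
    rw [h0, mul_zero]
    exact dvd_zero _

/-! ### The power formula and divided powers of the partial derivatives -/

namespace HigherDerivation

variable {A : Type*} [CommRing A] {n : ℕ} {f : Fin n → MvPolynomial (Fin n) A}
  {θ : HigherDerivation n (MvPolynomial (Fin n) A)}

theorem componentAt_eq_coeff_axisHom (i : Fin n) (L : ℕ) (g : MvPolynomial (Fin n) A) :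
    θ.componentAt i L g
      = PowerSeries.coeff L (axisHom (MvPolynomial (Fin n) A) i (θ.toRingHom g)) :=
  (coeff_axisHom _ _ _).symm

theorem componentAt_sum {ι : Type*} (s : Finset ι) (g : ι → MvPolynomial (Fin n) A) (i : Fin n)
    (L : ℕ) : θ.componentAt i L (∑ a ∈ s, g a) = ∑ a ∈ s, θ.componentAt i L (g a) := by
  simp only [componentAt, component, map_sum]

theorem componentAt_prod_pow (hθ : ∀ j, θ.toRingHom (f j) = C (f j) + X j) (i : Fin n) (L : ℕ)
    (α : Fin n → ℕ) :
    θ.componentAt i L (∏ j, f j ^ α j)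
      = ((α i).choose L : MvPolynomial (Fin n) A) *
          ∏ j, f j ^ ((α - Pi.single i L : Fin n → ℕ) j) := by
  rw [componentAt_eq_coeff_axisHom]
  simp only [map_prod, map_pow, hθ, map_add, axisHom_C, axisHom_X]
  have hprod : ∏ j, f j ^ ((α - Pi.single i L : Fin n → ℕ) j)
      = f i ^ (α i - L) * ∏ j ∈ Finset.univ.erase i,
          f j ^ ((α - Pi.single i L : Fin n → ℕ) j) := by
    rw [← Finset.mul_prod_erase _ _ (Finset.mem_univ i), Pi.sub_apply, Pi.single_eq_same]
  rw [← Finset.mul_prod_erase _ _ (Finset.mem_univ i), hprod]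
  have h1 : ∏ j ∈ Finset.univ.erase i,
      (PowerSeries.C (f j) + if j = i then PowerSeries.X else 0) ^ α j
      = PowerSeries.C (∏ j ∈ Finset.univ.erase i, f j ^ ((α - Pi.single i L : Fin n → ℕ) j)) := by
    rw [map_prod]
    refine Finset.prod_congr rfl fun j hj => ?_
    have hj := Finset.ne_of_mem_erase hj
    simp [hj]
  rw [h1, PowerSeries.coeff_mul_C, if_pos rfl]
  have h2 : (PowerSeries.C (f i) + PowerSeries.X : PowerSeries (MvPolynomial (Fin n) A)) ^ α i
      = (((Polynomial.X + Polynomial.C (f i)) ^ α i :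
          Polynomial (MvPolynomial (Fin n) A)) : PowerSeries (MvPolynomial (Fin n) A)) := by
    simp [add_comm]
  rw [h2, Polynomial.coeff_coe, Polynomial.coeff_X_add_C_pow]
  ring

/-- Along the axis `T_i`, the image of `a(x^(p^N))` is congruent to itself as a constant modulo `T_i
^ (L + 1)`, so it passes through the coefficient of `T_i ^ L` as a scalar. By the congruence lemma
this need only be checked on the variables. -/
theorem componentAt_expand_mul (hC : ∀ a, θ.toRingHom (MvPolynomial.C a) = C (MvPolynomial.C a))
    {p e N L : ℕ} (hp : p.Prime) (hA : (p ^ e : A) = 0)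
    (hL : L ≠ 0 → ∀ m, m ≠ 0 → m ≤ L → e + m.factorization p ≤ N) (i : Fin n)
    (a g : MvPolynomial (Fin n) A) :
    θ.componentAt i L (MvPolynomial.expand (p ^ N) a * g)
      = MvPolynomial.expand (p ^ N) a * θ.componentAt i L g := by
  let R := MvPolynomial (Fin n) A
  have hR : (p ^ e : R) = 0 := by
    have := congrArg (MvPolynomial.C (σ := Fin n)) hA
    rwa [map_pow, map_natCast, map_zero] at this
  have key := MvPolynomial.map_sub_map_mem_of_congr
    (((axisHom R i).comp θ.toRingHom).comp (MvPolynomial.expand (p ^ N) : R →ₐ[A] R).toRingHom)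
    ((PowerSeries.C (R := R)).comp (MvPolynomial.expand (p ^ N) : R →ₐ[A] R).toRingHom)
    (Ideal.span {PowerSeries.X ^ (L + 1)}) ?_ ?_ a
  · rw [Ideal.mem_span_singleton] at key
    change _ ∣ axisHom R i (θ.toRingHom (MvPolynomial.expand (p ^ N) a))
      - PowerSeries.C (MvPolynomial.expand (p ^ N) a) at key
    have h := PowerSeries.X_pow_dvd_iff.mp
      (key.mul_right (axisHom R i (θ.toRingHom g))) L (Nat.lt_succ_self L)
    rw [sub_mul, map_sub, PowerSeries.coeff_C_mul, sub_eq_zero, ← map_mul, ← map_mul] at h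
    rw [componentAt_eq_coeff_axisHom, componentAt_eq_coeff_axisHom]
    exact h
  · intro b
    simp [hC, axisHom_C]
  · intro k
    rw [Ideal.mem_span_singleton]
    simp only [RingHom.comp_apply, AlgHom.toRingHom_eq_coe, RingHom.coe_coe,
      MvPolynomial.expand_X, map_pow]
    refine PowerSeries.X_pow_dvd_pow_sub_pow hp hR hL ?_
    rw [PowerSeries.X_dvd_iff, map_sub, sub_eq_zero, PowerSeries.constantCoeff_C,
      ← PowerSeries.coeff_zero_eq_constantCoeff_apply, coeff_axisHom, Finsupp.single_zero]
    exact θ.constantCoeff_toRingHom _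

theorem powerFormula (hC : ∀ a, θ.toRingHom (MvPolynomial.C a) = C (MvPolynomial.C a))
    (hθ : ∀ j, θ.toRingHom (f j) = C (f j) + X j) {p e N L : ℕ} (hp : p.Prime)
    (hA : (p ^ e : A) = 0)
    (hL : L ≠ 0 → ∀ m, m ≠ 0 → m ≤ L → e + m.factorization p ≤ N) (i : Fin n) :
    PowerFormula f θ (p ^ N) i L := by
  intro a
  rw [componentAt_sum]
  refine Finset.sum_congr rfl fun α _ => ?_
  rw [componentAt_expand_mul hC hp hA hL, componentAt_prod_pow hθ]

/-- The component `θ_i^{(1)}` as a derivation. -/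
noncomputable def derivationAt
    (hC : ∀ a, θ.toRingHom (MvPolynomial.C a) = C (MvPolynomial.C a)) (i : Fin n) :
    Derivation A (MvPolynomial (Fin n) A) (MvPolynomial (Fin n) A) :=
  Derivation.mk'
    { toFun := θ.componentAt i 1
      map_add' := fun g h => by simp only [componentAt, component, map_add]
      map_smul' := fun a g => by
        simp only [componentAt, component, MvPolynomial.smul_eq_C_mul, map_mul, hC,
          coeff_C_mul, RingHom.id_apply] }
    fun g h => by
      have h0 : ∀ g, coeff 0 (θ.toRingHom g) = g := θ.constantCoeff_toRingHom
      classical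
      change θ.componentAt i 1 (g * h) = g • θ.componentAt i 1 h + h • θ.componentAt i 1 g
      simp only [componentAt, component, map_mul, coeff_mul, Finsupp.antidiagonal_single,
        Finset.sum_map, smul_eq_mul]
      simp [Finset.Nat.antidiagonal_succ, h0, mul_comm]

theorem isPartialDerivative_derivationAt
    (hC : ∀ a, θ.toRingHom (MvPolynomial.C a) = C (MvPolynomial.C a))
    (hθ : ∀ j, θ.toRingHom (f j) = C (f j) + X j) (i : Fin n) :
    IsPartialDerivative f i (derivationAt hC i) := by
  classical
  intro j
  change coeff (Finsupp.single i 1) (θ.toRingHom (f j)) = _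
  rw [hθ, map_add, coeff_C_of_ne_zero (by simp), coeff_index_single_X, zero_add]
  simp [eq_comm]

/-- Iterativity for `e_i` and `L e_i` has binomial factor `L + 1`; these factors accumulate to the
factorial. -/
theorem IsIterative.factorial_smul_componentAt (hit : θ.IsIterative) (i : Fin n) (L : ℕ)
    (g : MvPolynomial (Fin n) A) :
    L.factorial • θ.componentAt i L g = (θ.componentAt i 1)^[L] g := by
  have hadd : ∀ (k : ℕ) g, θ.componentAt i 1 (k • g) = k • θ.componentAt i 1 g := by
    intro k g
    simp only [componentAt, component, map_nsmul]
  induction L with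
  | zero =>
    have : θ.componentAt i 0 g = g := by
      rw [componentAt, component, Finsupp.single_zero]
      exact θ.constantCoeff_toRingHom g
    simp [this]
  | succ L ih =>
    rw [Function.iterate_succ_apply', ← ih, hadd]
    have h := hit (Finsupp.single i 1) (Finsupp.single i L) g
    rw [← Finsupp.single_add, Finset.prod_eq_single i] at h
    · simp only [Finsupp.single_eq_same, Nat.choose_one_right] at h
      change θ.componentAt i 1 (θ.componentAt i L g) = (1 + L) • θ.componentAt i (1 + L) g at h
      rw [h, smul_smul, Nat.factorial_succ, add_comm 1 L, mul_comm]
    · intro j _ hj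
      simp [hj]
    · simp

end HigherDerivation

/-- By the chain rule, the Jacobian matrix kills the vector of values of `D' - D` on the variables,
and it is invertible. -/
theorem IsPartialDerivative.unique {A : Type*} [CommRing A] {n : ℕ}
    {f : Fin n → MvPolynomial (Fin n) A} (hf : IsUnit (jacobianMatrix f).det) {i : Fin n}
    {D D' : Derivation A (MvPolynomial (Fin n) A) (MvPolynomial (Fin n) A)}
    (hD : IsPartialDerivative f i D) (hD' : IsPartialDerivative f i D') : D' = D := by
  have happ : ∀ (s : Fin n → Derivation A (MvPolynomial (Fin n) A) (MvPolynomial (Fin n) A)) g,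
      (∑ k, s k) g = ∑ k, s k g := by
    intro s g
    have h := map_sum Derivation.coeFnAddMonoidHom s Finset.univ
    exact (congrFun h g).trans (Finset.sum_apply _ _ _)
  have chain : ∀ (E : Derivation A (MvPolynomial (Fin n) A) (MvPolynomial (Fin n) A)) g,
      E g = ∑ k, MvPolynomial.pderiv k g * E (MvPolynomial.X k) := by
    intro E g
    have : E = ∑ k, E (MvPolynomial.X k) • MvPolynomial.pderiv k := by
      refine MvPolynomial.derivation_ext fun l => ?_
      rw [happ]
      simp [MvPolynomial.pderiv_X, Pi.single_apply]
    conv_lhs => rw [this]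
    rw [happ]
    simp [mul_comm]
  have hv : (jacobianMatrix f).mulVec (fun k => (D' - D) (MvPolynomial.X k)) = 0 := by
    ext1 j
    change ∑ k, MvPolynomial.pderiv k (f j) * (D' - D) (MvPolynomial.X k) = 0
    rw [← chain, Derivation.sub_apply, hD j, hD' j, sub_self]
  have h0 := Matrix.mulVec_injective_of_isUnit ((Matrix.isUnit_iff_isUnit_det _).mpr hf)
    (hv.trans (Matrix.mulVec_zero _).symm)
  exact MvPolynomial.derivation_ext fun k => sub_eq_zero.mp (congrFun h0 k)

/-- The exponent may be negative, hence the rational power. This happens only for `L = 0`, when no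
`m` qualifies. -/
theorem add_factorization_le_of_lt_zpow {p e N L : ℕ} (hp : p.Prime)
    (h : (L : ℚ) < (p : ℚ) ^ ((N : ℤ) - (e : ℤ) + 1)) (m : ℕ) (hm0 : m ≠ 0) (hm : m ≤ L) :
    e + m.factorization p ≤ N := by
  have h1 : p ^ m.factorization p ≤ L := (Nat.ordProj_le p hm0).trans hm
  have h2 : (p : ℚ) ^ ((m.factorization p : ℕ) : ℤ) ≤ L := by
    rw [zpow_natCast]
    exact_mod_cast h1
  have h3 := (zpow_lt_zpow_iff_right₀ (by exact_mod_cast hp.one_lt)).mp (h2.trans_lt h)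
  omega

theorem factorization_le_padicValNat_factorial {p L : ℕ} (hp : p.Prime) (m : ℕ) (hm0 : m ≠ 0)
    (hm : m ≤ L) : m.factorization p ≤ padicValNat p L.factorial := by
  rw [← Nat.factorization_def _ hp]
  exact (Nat.factorization_le_iff_dvd hm0 L.factorial_ne_zero).mpr
    (Nat.dvd_factorial (Nat.pos_of_ne_zero hm0) hm) p

end Jacobian

theorem proposition4p8 {A : Type u} [CommRing A] {n : ℕ}
    (f : Fin n → MvPolynomial (Fin n) A) (hf : IsUnit (jacobianMatrix f).det) :
    -- `θ_f` is a well-defined iterative higher derivation on `A[f₁, …, f_n]`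
    ∃ hind : AlgebraicIndependent A f,
      (theta hind).IsIterative ∧
      -- it extends uniquely to a higher derivation on `A[x₁, …, x_n]`
      ∃ θ : HigherDerivation n (MvPolynomial (Fin n) A),
        θ.Extends (theta hind) ∧
        (∀ η : HigherDerivation n (MvPolynomial (Fin n) A),
          η.Extends (theta hind) → η = θ) ∧
        -- the formula in characteristic `p ^ e`
        (∀ p e : ℕ, p.Prime → CharP A (p ^ e) →
          (∀ (L : ℕ) (i : Fin n) (N : ℕ), (L : ℚ) < (p : ℚ) ^ ((N : ℤ) - (e : ℤ) + 1) →
            PowerFormula f θ (p ^ N) i L) ∧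
          (∀ (L : ℕ) (i : Fin n),
            PowerFormula f θ (p ^ (e + padicValNat p L.factorial)) i L)) ∧
        -- the extension is iterative, and its components are divided powers of `∂/∂f_i`
        θ.IsIterative ∧
        (∀ i : Fin n,
          ∃ D : Derivation A (MvPolynomial (Fin n) A) (MvPolynomial (Fin n) A),
            IsPartialDerivative f i D ∧
            (∀ D' : Derivation A (MvPolynomial (Fin n) A) (MvPolynomial (Fin n) A),
              IsPartialDerivative f i D' → D' = D) ∧
            ∀ L : ℕ, 0 < L → ∀ g : MvPolynomial (Fin n) A,
              L.factorial • θ.componentAt i L g = (⇑D)^[L] g) ∧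
        -- functoriality under base change
        (∀ (A' : Type v) [CommRing A'] (phi : A →+* A'),
          ∃ hind' : AlgebraicIndependent A' (fun i => MvPolynomial.map phi (f i)),
          ∃ θ' : HigherDerivation n (MvPolynomial (Fin n) A'),
            θ'.Extends (theta hind') ∧
            (∀ η : HigherDerivation n (MvPolynomial (Fin n) A'),
              η.Extends (theta hind') → η = θ') ∧
            ∀ g : MvPolynomial (Fin n) A,
              θ'.toRingHom (MvPolynomial.map phi g) =
                MvPowerSeries.map (MvPolynomial.map phi) (θ.toRingHom g)) := by
  obtain ⟨hind, θ, hext⟩ := HigherDerivation.exists_extends_theta hf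
  obtain ⟨hC, hθ⟩ := (HigherDerivation.extends_theta_iff hind θ).mp hext
  have hit := HigherDerivation.isIterative_of_shift hf hC hθ
  -- Iterativity on `A[f]` is inherited from the extension to `A[x]`, where uniqueness of lifts is
  -- available.
  refine ⟨hind, hit.of_extends Subtype.val_injective hext, θ, hext,
    fun η hη => hext.eq_of_theta hf hη, ?_, hit, ?_, ?_⟩
  · intro p e hp hchar
    have hA : (p ^ e : A) = 0 := by
      exact_mod_cast CharP.cast_eq_zero A (p ^ e)
    exact ⟨fun L i N hL => HigherDerivation.powerFormula hC hθ hp hA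
        (fun _ => add_factorization_le_of_lt_zpow hp hL) i,
      fun L i => HigherDerivation.powerFormula hC hθ hp hA
        (fun _ m hm0 hm => Nat.add_le_add_left
          (factorization_le_padicValNat_factorial hp m hm0 hm) e) i⟩
  · intro i
    have hD := HigherDerivation.isPartialDerivative_derivationAt hC hθ i
    exact ⟨_, hD, fun D' hD' => hD.unique hf hD',
      fun L _ g => hit.factorial_smul_componentAt i L g⟩
  · intro A' _ phi
    have hf' := isUnit_det_jacobianMatrix_map hf phi
    obtain ⟨hind', θ', hext'⟩ := HigherDerivation.exists_extends_theta hf'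
    exact ⟨hind', θ', hext', fun η hη => hext'.eq_of_theta hf' hη,
      HigherDerivation.toRingHom_map_of_extends hf phi hext hext'⟩
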